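/- All rings are associative with identity $1\neq 0$, and all modules are unitary. A right (or left) $R$-module $M$ is called \emph{weakly uniserial} if for any two submodules $N,K$ of $M$ there is an injective $R$-homomorphism $N\to K$ or an injective $R$-homomorphism $K\to N$. A module is called \emph{$2$-generated} if it can be generated by two (not necessarily distinct) elements. \textbf{Theorem.} For a ring $R$, the following statements are equivalent: \begin{enumerate} \item[(a)] $R\cong M_n(D)$ (as rings) for some integer $n\ge 1$ and some division ring $D$. \item[(b)] Every right $R$-module is weakly uniserial. \item[(c)] Every finitely generated right $R$-module is weakly uniserial. \item[(d)] Every $2$-generated right $R$-module is weakly uniserial. \item[(e)] Every injective right $R$-module is weakly uniserial. \item[(b$'$)] Every left $R$-module is weakly uniserial. \item[(c$'$)] Every finitely generated left $R$-module is weakly uniserial. \item[(d$'$)] Every $2$-generated left $R$-module is weakly uniserial. \item[(e$'$)] Every injective left $R$-module is weakly uniserial. \end{enumerate} -/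

import Mathlib

universe u v

/-- A (left) module `M` over a ring `R` is weakly uniserial if for any two submodules `N`, `K`
of `M` there is an injective `R`-linear map `N → K` or an injective `R`-linear map `K → N`.
Right `R`-modules are modules over the opposite ring `Rᵐᵒᵖ`. -/
def IsWeaklyUniserial (R : Type*) (M : Type*) [Ring R] [AddCommGroup M] [Module R M] : Prop :=
  ∀ N K : Submodule R M,
    (∃ f : N →ₗ[R] K, Function.Injective f) ∨ (∃ f : K →ₗ[R] N, Function.Injective f)

/-- A module is 2-generated if it is generated by two (not necessarily distinct) elements. -/
def IsTwoGenerated (R : Type*) (M : Type*) [Ring R] [AddCommGroup M] [Module R M] : Prop :=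
  ∃ x y : M, Submodule.span R {x, y} = ⊤

/-!
The pivot is the condition that `R` is simple Artinian. It is equivalent to `R` being semisimple
with a single isomorphism class of simple left ideals, it is equivalent to `R` being a matrix ring
over a division ring by Wedderburn–Artin, and it is invariant under passing to `Rᵐᵒᵖ`. Hence only
left modules have to be treated, and the right-hand statements follow by applying the result to
`Rᵐᵒᵖ`.

Over a simple Artinian ring every module is a direct sum of copies of one simple module, so any two
modules embed one in the other by comparing the cardinals of the index sets
(`isWeaklyUniserial_of_isSimpleRing`). Weak uniseriality passes to submodules, and every module
embeds in an injective one, so the statement about injective modules already gives the statement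
about all modules.

The substance is that `R` is simple Artinian once `A × B` is weakly uniserial for all cyclic `A`
and `B` (`isSimpleRing_and_isArtinianRing_of_cyclic_prod`). Comparing two simple modules shows that
they are isomorphic. Comparing a simple module `S` with `R` shows that either `R` embeds in `S`,
and `R` is simple as a module, or `S` is isomorphic to a left ideal `I`. In the second case choose
a left ideal `T` maximal among those disjoint from `I`. The image of `I` in `R ⧸ T` is simple and
lies in every nonzero submodule; such a module contains no copy of `S × S`, so comparison inside
`(R ⧸ T) × S` embeds `R ⧸ T` in `S × S`, which makes `R ⧸ T` semisimple and therefore simple. Thus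
`I` is a direct summand of `R`, so `S` is projective. No maximal left ideal can then contain all
simple left ideals, that is, `R` is semisimple.
-/

open Function

/-! ### Weak uniseriality and embeddings -/

section WeaklyUniserial

variable {R : Type*} [Ring R] {M N A B : Type*} [AddCommGroup M] [Module R M]
  [AddCommGroup N] [Module R N] [AddCommGroup A] [Module R A] [AddCommGroup B] [Module R B]

/-- Modules embedding in a common weakly uniserial module are comparable. -/
theorem IsWeaklyUniserial.exists_injective_or (h : IsWeaklyUniserial R M)
    (f : A →ₗ[R] M) (hf : Injective f) (g : B →ₗ[R] M) (hg : Injective g) :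
    (∃ k : A →ₗ[R] B, Injective k) ∨ ∃ k : B →ₗ[R] A, Injective k := by
  let ef := LinearEquiv.ofInjective f hf
  let eg := LinearEquiv.ofInjective g hg
  refine (h (LinearMap.range f) (LinearMap.range g)).imp ?_ ?_
  · rintro ⟨k, hk⟩
    exact ⟨eg.symm.toLinearMap ∘ₗ k ∘ₗ ef.toLinearMap,
      eg.symm.injective.comp (hk.comp ef.injective)⟩
  · rintro ⟨k, hk⟩
    exact ⟨ef.symm.toLinearMap ∘ₗ k ∘ₗ eg.toLinearMap,
      ef.symm.injective.comp (hk.comp eg.injective)⟩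

theorem IsWeaklyUniserial.of_injective (h : IsWeaklyUniserial R M)
    (f : N →ₗ[R] M) (hf : Injective f) : IsWeaklyUniserial R N := fun A B ↦
  h.exists_injective_or (f ∘ₗ A.subtype) (hf.comp A.subtype_injective)
    (f ∘ₗ B.subtype) (hf.comp B.subtype_injective)

theorem IsWeaklyUniserial.exists_injective_or_of_prod (h : IsWeaklyUniserial R (A × B)) :
    (∃ k : A →ₗ[R] B, Injective k) ∨ ∃ k : B →ₗ[R] A, Injective k :=
  h.exists_injective_or (LinearMap.inl R A B) LinearMap.inl_injective
    (LinearMap.inr R A B) LinearMap.inr_injective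

theorem IsWeaklyUniserial.nonempty_linearEquiv_of_prod [IsSimpleModule R A] [IsSimpleModule R B]
    (h : IsWeaklyUniserial R (A × B)) : Nonempty (A ≃ₗ[R] B) := by
  have := IsSimpleModule.nontrivial R A
  have := IsSimpleModule.nontrivial R B
  rcases h.exists_injective_or_of_prod with ⟨k, hk⟩ | ⟨k, hk⟩
  · exact ⟨LinearEquiv.ofBijective k
      (LinearMap.bijective_of_ne_zero (LinearMap.ne_zero_of_injective hk))⟩
  · exact ⟨(LinearEquiv.ofBijective k
      (LinearMap.bijective_of_ne_zero (LinearMap.ne_zero_of_injective hk))).symm⟩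

theorem IsTwoGenerated.finite (h : IsTwoGenerated R M) : Module.Finite R M := by
  obtain ⟨x, y, hxy⟩ := h
  exact Module.finite_def.2 (hxy ▸ Submodule.fg_span (Set.toFinite _))

theorem IsTwoGenerated.of_surjective (h : IsTwoGenerated R M) (f : M →ₗ[R] N)
    (hf : Surjective f) : IsTwoGenerated R N := by
  obtain ⟨x, y, hxy⟩ := h
  refine ⟨f x, f y, ?_⟩
  rw [← Set.image_pair, Submodule.span_image, hxy, Submodule.map_top, LinearMap.range_eq_top.2 hf]

theorem isTwoGenerated_prod {x : A} {y : B} (hx : Submodule.span R {x} = ⊤)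
    (hy : Submodule.span R {y} = ⊤) : IsTwoGenerated R (A × B) := by
  refine ⟨(x, 0), (0, y), Submodule.eq_top_iff'.2 fun ⟨a, b⟩ ↦ ?_⟩
  obtain ⟨r, rfl⟩ := (Submodule.span_singleton_eq_top_iff R x).1 hx a
  obtain ⟨s, rfl⟩ := (Submodule.span_singleton_eq_top_iff R y).1 hy b
  exact Submodule.mem_span_pair.2 ⟨r, s, by simp⟩

end WeaklyUniserial

/-! ### Modules over a simple Artinian ring -/

section SimpleArtinian

variable {R : Type*} [Ring R]

/-- Submodules are direct sums of copies of one simple module, and the number of copies is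
comparable. -/
theorem isWeaklyUniserial_of_isSimpleRing [IsSimpleRing R] [IsArtinianRing R]
    (M : Type*) [AddCommGroup M] [Module R M] : IsWeaklyUniserial R M := by
  intro N K
  rcases subsingleton_or_nontrivial M with hM | hM
  · exact .inl ⟨0, injective_of_subsingleton _⟩
  obtain ⟨S, hS⟩ := IsSemisimpleModule.exists_simple_submodule R M
  have hM : IsIsotypicOfType R M S := IsSimpleRing.isIsotypic R M S
  obtain ⟨ι, ⟨e⟩⟩ := (hM.of_injective _ N.subtype_injective).linearEquiv_finsupp
  obtain ⟨κ, ⟨e'⟩⟩ := (hM.of_injective _ K.subtype_injective).linearEquiv_finsupp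
  rcases Embedding.total ι κ with ⟨⟨j⟩⟩ | ⟨⟨j⟩⟩
  · exact .inl ⟨e'.symm.toLinearMap ∘ₗ Finsupp.lmapDomain S R j ∘ₗ e.toLinearMap,
      e'.symm.injective.comp ((Finsupp.mapDomain_injective j.injective).comp e.injective)⟩
  · exact .inr ⟨e.symm.toLinearMap ∘ₗ Finsupp.lmapDomain S R j ∘ₗ e'.toLinearMap,
      e.symm.injective.comp ((Finsupp.mapDomain_injective j.injective).comp e'.injective)⟩

end SimpleArtinian

/-! ### Modules with a least nonzero submodule -/

section Monolith

variable {R : Type*} [Ring R] {P : Type*} [AddCommGroup P] [Module R P]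

/-- If `S` is simple and contained in every nonzero submodule of `P`, and `P × S` is weakly
uniserial, then `P` is simple: `S × S` does not embed in `P`, so `P` embeds in `S × S`. -/
theorem eq_top_of_isWeaklyUniserial_prod (S : Submodule R P) [IsSimpleModule R S]
    (hS : ∀ C : Submodule R P, C ≠ ⊥ → S ≤ C) (h : IsWeaklyUniserial R (P × S)) : S = ⊤ := by
  have hS0 : S ≠ ⊥ := (isSimpleModule_iff_isAtom.1 ‹_›).1
  have hnt : Nontrivial S := IsSimpleModule.nontrivial R S
  rcases h.exists_injective_or (LinearMap.inl R P S) LinearMap.inl_injective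
    (S.subtype.prodMap (LinearMap.id : S →ₗ[R] S))
    (S.subtype_injective.prodMap injective_id) with ⟨k, hk⟩ | ⟨k, hk⟩
  · have : IsSemisimpleModule R (S × S) :=
      IsSemisimpleModule.congr (LinearEquiv.finTwoArrow R S).symm
    have : IsSemisimpleModule R P := .of_injective k hk
    obtain ⟨C, hC⟩ := exists_isCompl S
    have hC0 : C = ⊥ := by
      by_contra hne
      exact hS0 (hC.disjoint.eq_bot_of_le (hS C hne))
    simpa [hC0] using hC.sup_eq_top
  · -- The images of the two factors are nonzero and disjoint, yet both contain `S`.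
    have h₁ := hS _ (mt LinearMap.range_eq_bot.1 (LinearMap.ne_zero_of_injective
      (f := k ∘ₗ LinearMap.inl R S S) (hk.comp LinearMap.inl_injective)))
    have h₂ := hS _ (mt LinearMap.range_eq_bot.1 (LinearMap.ne_zero_of_injective
      (f := k ∘ₗ LinearMap.inr R S S) (hk.comp LinearMap.inr_injective)))
    obtain ⟨s, hs, hs0⟩ := S.exists_mem_ne_zero_of_ne_bot hS0
    obtain ⟨a, ha⟩ := h₁ hs
    obtain ⟨b, hb⟩ := h₂ hs
    have hab : ((a, 0) : S × S) = (0, b) := hk (ha.trans hb.symm)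
    have ha0 : a = 0 := congrArg Prod.fst hab
    exact absurd (by rw [← ha, ha0, map_zero]) hs0

theorem Submodule.exists_maximal_disjoint (S : Submodule R P) :
    ∃ T, Maximal (fun T : Submodule R P ↦ Disjoint S T) T := by
  obtain ⟨T, -, hT⟩ := zorn_le_nonempty₀ {T : Submodule R P | Disjoint S T}
    (fun c hc hchain _ _ ↦ ⟨sSup c, hchain.directedOn.disjoint_sSup_right.2 fun T hT ↦ hc hT,
      fun T hT ↦ le_sSup hT⟩) ⊥ disjoint_bot_right
  exact ⟨T, hT⟩

end Monolith

/-! ### Comparison of cyclic modules -/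

section Cyclic

universe w

variable {R : Type w} [Ring R]

/-- A simple left ideal `I` is a direct summand: a left ideal maximal among those disjoint from
`I` is a complement. -/
theorem exists_isCompl_of_cyclic_prod
    (H : ∀ (A B : Type w) [AddCommGroup A] [AddCommGroup B] [Module R A] [Module R B],
      (∃ x : A, Submodule.span R {x} = ⊤) → (∃ y : B, Submodule.span R {y} = ⊤) →
        IsWeaklyUniserial R (A × B))
    (I : Submodule R R) [IsSimpleModule R I] : ∃ T, IsCompl I T := by
  obtain ⟨T, hT⟩ := I.exists_maximal_disjoint
  have hinj : Injective (T.mkQ ∘ₗ I.subtype) := by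
    rw [← LinearMap.ker_eq_bot, LinearMap.ker_comp, Submodule.ker_mkQ,
      ← Submodule.disjoint_iff_comap_eq_bot]
    exact hT.prop
  let S := LinearMap.range (T.mkQ ∘ₗ I.subtype)
  have hS : IsSimpleModule R S := .congr (LinearEquiv.ofInjective _ hinj).symm
  have hle : ∀ C : Submodule R (R ⧸ T), C ≠ ⊥ → S ≤ C := by
    intro C hC
    by_contra hSC
    have hdis : Disjoint S C := (isSimpleModule_iff_isAtom.1 hS).not_le_iff_disjoint.1 hSC
    -- The preimage of `C` still avoids `I`, so it is `T` by maximality.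
    have hdisj : Disjoint I (C.comap T.mkQ) := by
      rw [Submodule.disjoint_def] at hdis ⊢
      intro x hx hxC
      have h0 : T.mkQ x = 0 := hdis _ ⟨⟨x, hx⟩, rfl⟩ hxC
      exact congrArg Subtype.val (hinj (a₁ := ⟨x, hx⟩) (a₂ := 0) (by simpa using h0))
    have hCT : C.comap T.mkQ ≤ T := hT.le_of_ge hdisj (by
      simpa using Submodule.comap_mono (f := T.mkQ) (bot_le : ⊥ ≤ C))
    refine hC (eq_bot_iff.2 fun y hy ↦ ?_)
    obtain ⟨x, rfl⟩ := T.mkQ_surjective y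
    simpa using hCT hy
  have hnt : Nontrivial S := IsSimpleModule.nontrivial R S
  obtain ⟨s, hs⟩ := exists_ne (0 : S)
  have htop : S = ⊤ := eq_top_of_isWeaklyUniserial_prod S hle
    (H (R ⧸ T) S ⟨T.mkQ 1, by
      rw [← Set.image_singleton, Submodule.span_image, ← Ideal.span, Ideal.span_singleton_one]
      simp⟩ ⟨s, IsSimpleModule.span_singleton_eq_top R hs⟩)
  refine ⟨T, hT.prop, codisjoint_iff.2 (Submodule.eq_top_iff'.2 fun x ↦ ?_)⟩
  obtain ⟨i, hi⟩ : T.mkQ x ∈ S := htop ▸ Submodule.mem_top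
  refine Submodule.mem_sup.2 ⟨i, i.2, x - i, ?_, by abel⟩
  exact (Submodule.Quotient.eq T).1 hi.symm

/-- All simple modules are isomorphic, and either `R` embeds in a simple module or some, hence
every, simple module is projective; both cases make `R` semisimple. -/
theorem isSimpleRing_and_isArtinianRing_of_cyclic_prod [Nontrivial R]
    (H : ∀ (A B : Type w) [AddCommGroup A] [AddCommGroup B] [Module R A] [Module R B],
      (∃ x : A, Submodule.span R {x} = ⊤) → (∃ y : B, Submodule.span R {y} = ⊤) →
        IsWeaklyUniserial R (A × B)) :
    IsSimpleRing R ∧ IsArtinianRing R := by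
  have hcyc : ∀ (A : Type w) [AddCommGroup A] [Module R A] [IsSimpleModule R A],
      ∃ x : A, Submodule.span R {x} = ⊤ := by
    intro A _ _ _
    have := IsSimpleModule.nontrivial R A
    obtain ⟨x, hx⟩ := exists_ne (0 : A)
    exact ⟨x, IsSimpleModule.span_singleton_eq_top R hx⟩
  have hiso : ∀ (A B : Type w) [AddCommGroup A] [AddCommGroup B] [Module R A] [Module R B]
      [IsSimpleModule R A] [IsSimpleModule R B], Nonempty (A ≃ₗ[R] B) := by
    intro A B _ _ _ _ _ _
    exact (H A B (hcyc A) (hcyc B)).nonempty_linearEquiv_of_prod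
  refine isSimpleRing_isArtinianRing_iff.2 ⟨?_, fun I _ J _ ↦ hiso J I, inferInstance⟩
  obtain ⟨m, hm⟩ := Ideal.exists_maximal R
  have : IsSimpleModule R (R ⧸ m) := isSimpleModule_iff_isCoatom.2 hm.out
  rcases (H (R ⧸ m) R (hcyc _) ⟨1, Ideal.span_singleton_one⟩).exists_injective_or_of_prod with
    ⟨f, hf⟩ | ⟨f, hf⟩
  · let I := LinearMap.range f
    have hI : IsSimpleModule R I := .congr (LinearEquiv.ofInjective f hf).symm
    obtain ⟨T, hT⟩ := exists_isCompl_of_cyclic_prod H I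
    have hproj : Module.Projective R I :=
      .of_split I.subtype (I.projectionOnto T hT) (LinearMap.ext fun x ↦ by simp)
    refine IsSemisimpleModule.of_sSup_simples_eq_top ?_
    by_contra hne
    obtain ⟨m', hm', hle⟩ := (eq_top_or_exists_le_coatom _).resolve_left hne
    -- A splitting of `R → R ⧸ m' ≃ I` has as image a simple left ideal not contained in `m'`.
    have : IsSimpleModule R (R ⧸ m') := isSimpleModule_iff_isCoatom.2 hm'
    obtain ⟨e⟩ := hiso (R ⧸ m') I
    obtain ⟨k, hk⟩ := Module.projective_lifting_property (e.toLinearMap ∘ₗ m'.mkQ) LinearMap.id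
      (e.surjective.comp m'.mkQ_surjective)
    have hkinj : Injective k := by
      refine HasLeftInverse.injective ⟨e ∘ m'.mkQ, fun x ↦ ?_⟩
      exact LinearMap.congr_fun hk x
    have hksimple : IsSimpleModule R (LinearMap.range k) :=
      .congr (LinearEquiv.ofInjective k hkinj).symm
    have := IsSimpleModule.nontrivial R I
    obtain ⟨x, hx⟩ := exists_ne (0 : I)
    have hkx : k x ∈ m' := hle (le_sSup (a := LinearMap.range k) hksimple ⟨x, rfl⟩)
    have h0 : m'.mkQ (k x) = 0 := (Submodule.Quotient.mk_eq_zero m').2 hkx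
    have h1 : e (m'.mkQ (k x)) = x := LinearMap.congr_fun hk x
    exact hx (by rw [← h1, h0, map_zero])
  · exact IsSemisimpleModule.of_injective f hf

end Cyclic

/-! ### The equivalences for left modules, and passage to the opposite ring -/

theorem exists_ringEquiv_matrix_iff (R : Type u) [Ring R] :
    (∃ (n : ℕ) (_ : 1 ≤ n) (D : Type u) (_ : DivisionRing D),
      Nonempty (R ≃+* Matrix (Fin n) (Fin n) D)) ↔ IsSimpleRing R ∧ IsArtinianRing R := by
  constructor
  · rintro ⟨n, hn, D, _, ⟨e⟩⟩
    have : Nonempty (Fin n) := ⟨⟨0, hn⟩⟩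
    have hs : IsSimpleRing R := .of_ringEquiv e.symm inferInstance
    exact ⟨hs, IsSimpleRing.isSemisimpleRing_iff_isArtinianRing.1 e.symm.isSemisimpleRing⟩
  · rintro ⟨_, _⟩
    obtain ⟨n, hn, D, hD, e⟩ := IsSimpleRing.exists_ringEquiv_matrix_divisionRing R
    exact ⟨n, NeZero.one_le, D, hD, e⟩

theorem isSimpleRing_and_isArtinianRing_mulOpposite_iff (R : Type*) [Ring R] :
    IsSimpleRing Rᵐᵒᵖ ∧ IsArtinianRing Rᵐᵒᵖ ↔ IsSimpleRing R ∧ IsArtinianRing R := by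
  constructor
  · rintro ⟨_, _⟩
    have hs : IsSimpleRing R := .of_ringEquiv (RingEquiv.opOp R).symm inferInstance
    exact ⟨hs, IsSimpleRing.isSemisimpleRing_iff_isArtinianRing.1
      (isSemisimpleRing_mulOpposite_iff.1 inferInstance)⟩
  · rintro ⟨_, _⟩
    exact ⟨inferInstance, IsSimpleRing.isSemisimpleRing_iff_isArtinianRing.1 inferInstance⟩

theorem exists_injective_linearMap_to_injective (R : Type u) [Ring R] (M : Type (max u v))
    [AddCommGroup M] [Module R M] :
    ∃ (E : Type (max u v)) (_ : AddCommGroup E) (_ : Module R E),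
      Module.Injective R E ∧ ∃ f : M →ₗ[R] E, Injective f := by
  have : CategoryTheory.EnoughInjectives (ModuleCat.{max u v} R) :=
    ModuleCat.enoughInjectives.{max u v, u} R
  let X := ModuleCat.of R M
  let E : ModuleCat.{max u v} R := CategoryTheory.Injective.under X
  have hE : CategoryTheory.Injective E := CategoryTheory.Injective.injective_under X
  exact ⟨E, inferInstance, inferInstance,
    Module.injective_module_of_injective_object R E (inj := hE),
    (CategoryTheory.Injective.ι X).hom, (ModuleCat.mono_iff_injective _).1 inferInstance⟩

/-- The one-sided form of the equivalence. Modules live in an arbitrarily large universe, and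
cyclic modules over `R`, which live in the universe of `R`, are lifted to it. -/
theorem isWeaklyUniserial_tfae (R : Type u) [Ring R] [Nontrivial R] :
    List.TFAE [
      IsSimpleRing R ∧ IsArtinianRing R,
      ∀ (M : Type (max u v)) [AddCommGroup M] [Module R M], IsWeaklyUniserial R M,
      ∀ (M : Type (max u v)) [AddCommGroup M] [Module R M],
        Module.Finite R M → IsWeaklyUniserial R M,
      ∀ (M : Type (max u v)) [AddCommGroup M] [Module R M],
        IsTwoGenerated R M → IsWeaklyUniserial R M,
      ∀ (M : Type (max u v)) [AddCommGroup M] [Module R M],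
        Module.Injective R M → IsWeaklyUniserial R M] := by
  tfae_have 1 → 2 := by
    rintro ⟨_, _⟩ M _ _
    exact isWeaklyUniserial_of_isSimpleRing M
  tfae_have 2 → 3 := fun h M _ _ _ ↦ h M
  tfae_have 3 → 4 := fun h M _ _ hM ↦ h M hM.finite
  tfae_have 4 → 1 := by
    intro h
    refine isSimpleRing_and_isArtinianRing_of_cyclic_prod fun A B _ _ _ _ ⟨x, hx⟩ ⟨y, hy⟩ ↦ ?_
    let e : ULift.{max u v} (A × B) ≃ₗ[R] A × B := ULift.moduleEquiv
    exact (h _ ((isTwoGenerated_prod hx hy).of_surjective e.symm.toLinearMap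
      e.symm.surjective)).of_injective e.symm.toLinearMap e.symm.injective
  tfae_have 2 → 5 := fun h M _ _ _ ↦ h M
  tfae_have 5 → 2 := by
    intro h M _ _
    obtain ⟨E, _, _, hE, f, hf⟩ := exists_injective_linearMap_to_injective.{u, v} R M
    exact (h E hE).of_injective f hf
  tfae_finish

theorem mainTheorem1 (R : Type u) [Ring R] [Nontrivial R] :
    List.TFAE [
      -- `R` is a full matrix ring over a division ring
      ∃ (n : ℕ) (_ : 1 ≤ n) (D : Type u) (_ : DivisionRing D),
        Nonempty (R ≃+* Matrix (Fin n) (Fin n) D),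
      -- right modules
      ∀ (M : Type (max u v)) [AddCommGroup M] [Module Rᵐᵒᵖ M], IsWeaklyUniserial Rᵐᵒᵖ M,
      ∀ (M : Type (max u v)) [AddCommGroup M] [Module Rᵐᵒᵖ M],
        Module.Finite Rᵐᵒᵖ M → IsWeaklyUniserial Rᵐᵒᵖ M,
      ∀ (M : Type (max u v)) [AddCommGroup M] [Module Rᵐᵒᵖ M],
        IsTwoGenerated Rᵐᵒᵖ M → IsWeaklyUniserial Rᵐᵒᵖ M,
      ∀ (M : Type (max u v)) [AddCommGroup M] [Module Rᵐᵒᵖ M],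
        Module.Injective Rᵐᵒᵖ M → IsWeaklyUniserial Rᵐᵒᵖ M,
      -- left modules
      ∀ (M : Type (max u v)) [AddCommGroup M] [Module R M], IsWeaklyUniserial R M,
      ∀ (M : Type (max u v)) [AddCommGroup M] [Module R M],
        Module.Finite R M → IsWeaklyUniserial R M,
      ∀ (M : Type (max u v)) [AddCommGroup M] [Module R M],
        IsTwoGenerated R M → IsWeaklyUniserial R M,
      ∀ (M : Type (max u v)) [AddCommGroup M] [Module R M],
        Module.Injective R M → IsWeaklyUniserial R M] := by
  have hL := isWeaklyUniserial_tfae.{u, v} R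
  have hR := isWeaklyUniserial_tfae.{u, v} Rᵐᵒᵖ
  rw [isSimpleRing_and_isArtinianRing_mulOpposite_iff R] at hR
  rw [exists_ringEquiv_matrix_iff R]
  tfae_have 1 ↔ 2 := hR.out 0 1
  tfae_have 1 ↔ 3 := hR.out 0 2
  tfae_have 1 ↔ 4 := hR.out 0 3
  tfae_have 1 ↔ 5 := hR.out 0 4
  tfae_have 1 ↔ 6 := hL.out 0 1
  tfae_have 1 ↔ 7 := hL.out 0 2
  tfae_have 1 ↔ 8 := hL.out 0 3
  tfae_have 1 ↔ 9 := hL.out 0 4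
  tfae_finish
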